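/- Fix an integer $d\ge 1$, write $M_n=M_n(\mathbb C)$, $M_n^d$ for the set of $d$-tuples of complex $n\times n$ matrices, and $M_{p,n}$ for the set of complex $p\times n$ matrices. For $X\in M_p^d$ and $V\in M_{p,n}$ put $V^*XV=(V^*X_1V,\dots,V^*X_dV)\in M_n^d$. Tuples $X,Y\in M_n^d$ are unitarily equivalent if $Y=U^*XU$ for some unitary $U\in M_n$; tuples of different sizes are never unitarily equivalent. A set $\mathcal S=\bigsqcup_{n\ge1}\mathcal S_n\subseteq\bigsqcup_{n\ge1}M_n^d$ (with levels $\mathcal S_n\subseteq M_n^d$) is *matrix convex* if $X\oplus Y\in\mathcal S_{m+n}$ for all $X\in\mathcal S_m$, $Y\in\mathcal S_n$, and $(\phi(X_1),\dots,\phi(X_d))\in\mathcal S_k$ for all $X\in\mathcal S_m$ and all unital completely positive maps $\phi:M_m\to M_k$ ($m,n,k\ge 1$). It is *closed* (*bounded*) if every level $\mathcal S_n$ is closed (bounded). A *matrix convex combination* of points $X^{(i)}\in\mathcal S_{n_i}$ ($1\le i\le k$) is a sum $\sum_{i=1}^k V_i^*X^{(i)}V_i$ with $V_i\in M_{n_i,n}$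 and $\sum_{i=1}^k V_i^*V_i=I_n$; it is *proper* if $\operatorname{rank}V_i=n_i$ for all $i$, and *weakly proper* if $V_i\ne0$ for all $i$. A point $X\in\mathcal S_n$ is - a *matrix extreme point* of $\mathcal S$ if, whenever $X=\sum_{i=1}^kV_i^*X^{(i)}V_i$ is a proper matrix convex combination of points $X^{(i)}$ of $\mathcal S$, every $X^{(i)}$ is unitarily equivalent to $X$; - an *absolute extreme point* of $\mathcal S$ if, whenever $X=\sum_{i=1}^kV_i^*X^{(i)}V_i$ is a weakly proper matrix convex combination of points $X^{(i)}$ of $\mathcal S$, every $X^{(i)}$ is unitarily equivalent to $X$ or to $X\oplus Z_i$ for some $Z_i\in\mathcal S$. Let $\mathcal S$ be a closed and bounded matrix convex set. A point $X\in\mathcal S$ is a *crucial matrix extreme point* of $\mathcal S$ if $X$ does not belong to the closed matrix convex hull (the smallest closed matrix convex set containing it) of $$\mathcal C=\{M\in\mathcal S: M\text{ is a matrix extreme point of }\mathcal S\text{ and }M\text{ is not unitarily equivalent to }X\}.$$ **Proposition.** Let $\mathcal S$ be a closed and bounded matrix convex set. Then every crucial matrix extreme point of $\mathcal S$ is an absolute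 extreme point of $\mathcal S$. -/

import Mathlib

open scoped Matrix

/-- A `d`-tuple of complex `n × n` matrices, i.e. an element of `M_n^d`, with the product
topology (`Fin d → Matrix _ _ ℂ`). -/
abbrev MatTuple (d n : ℕ) : Type := Fin d → Matrix (Fin n) (Fin n) ℂ

/-- A subset of the disjoint union, over the integers `n ≥ 1`, of the spaces `M_n^d`, given by its
levels. Sizes are natural numbers, so the level of size `0`, which is not part of that disjoint
union, is required to be empty. -/
structure FreeSet (d : ℕ) where
  level : ∀ n : ℕ, Set (MatTuple d n)
  level_zero : level 0 = ∅

namespace MatTuple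

variable {d : ℕ}

/-- The direct sum `X ⊕ Y`, formed entrywise as a block diagonal matrix. -/
def directSum {m n : ℕ} (X : MatTuple d m) (Y : MatTuple d n) : MatTuple d (m + n) :=
  fun j => Matrix.reindex finSumFinEquiv finSumFinEquiv (Matrix.fromBlocks (X j) 0 0 (Y j))

/-- `X` and `Y` are unitarily equivalent: `Y = U* X U` for a unitary `U`. The sizes need not be
assumed equal, since the two equations `U* U = 1` and `U U* = 1` force this. -/
def UnitarilyEquivalent {m n : ℕ} (X : MatTuple d m) (Y : MatTuple d n) : Prop :=
  ∃ U : Matrix (Fin m) (Fin n) ℂ, Uᴴ * U = 1 ∧ U * Uᴴ = 1 ∧ ∀ j, Y j = Uᴴ * X j * U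

end MatTuple

namespace FreeSet

variable {d : ℕ}

section UCP

open scoped MatrixOrder Matrix.Norms.L2Operator CStarAlgebra

/-- `S` is closed under (entrywise application of) all unital completely positive maps
`M_m → M_k`, `m, k ≥ 1`. Here `M_m` is the C⋆-algebra of `m × m` matrices with the operator norm
and its usual (Loewner) order. -/
def ClosedUnderUCP (S : FreeSet d) : Prop :=
  ∀ (m k : ℕ), 0 < m → 0 < k →
    ∀ φ : Matrix (Fin m) (Fin m) ℂ →CP Matrix (Fin k) (Fin k) ℂ, φ 1 = 1 →
      ∀ X ∈ S.level m, (fun j => φ (X j)) ∈ S.level k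

end UCP

/-- A free set is matrix convex if it is closed under direct sums and under unital completely
positive maps. -/
def IsMatrixConvex (S : FreeSet d) : Prop :=
  (∀ (m n : ℕ), ∀ X ∈ S.level m, ∀ Y ∈ S.level n, X.directSum Y ∈ S.level (m + n)) ∧
    S.ClosedUnderUCP

/-- Every level is closed. -/
def IsLevelwiseClosed (S : FreeSet d) : Prop :=
  ∀ n, IsClosed (S.level n)

/-- Every level is bounded. (Boundedness is expressed through the entries of the matrices, since
all norms on the finite-dimensional space `M_n^d` are equivalent.) -/
def IsLevelwiseBounded (S : FreeSet d) : Prop :=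
  ∀ n, ∃ C : ℝ, ∀ X ∈ S.level n, ∀ j a b, ‖X j a b‖ ≤ C

/-- `X = ∑ i, V_i* Y_i V_i` is a matrix convex combination of the points `Y_i` of `S`, where `Y_i`
has size `s i`. -/
def IsMatrixConvexCombination (S : FreeSet d) {n : ℕ} (X : MatTuple d n) {k : ℕ} (s : Fin k → ℕ)
    (Y : ∀ i, MatTuple d (s i)) (V : ∀ i, Matrix (Fin (s i)) (Fin n) ℂ) : Prop :=
  (∀ i, Y i ∈ S.level (s i)) ∧ ∑ i, (V i)ᴴ * V i = 1 ∧ ∀ j, X j = ∑ i, (V i)ᴴ * Y i j * V i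

/-- `X` is a matrix extreme point of `S`: in every proper matrix convex combination of points of
`S` that is equal to `X`, all those points are unitarily equivalent to `X`. -/
def IsMatrixExtremePoint (S : FreeSet d) {n : ℕ} (X : MatTuple d n) : Prop :=
  X ∈ S.level n ∧
    ∀ (k : ℕ) (s : Fin k → ℕ) (Y : ∀ i, MatTuple d (s i)) (V : ∀ i, Matrix (Fin (s i)) (Fin n) ℂ),
      S.IsMatrixConvexCombination X s Y V → (∀ i, (V i).rank = s i) →
        ∀ i, (Y i).UnitarilyEquivalent X

/-- `X` is an absolute extreme point of `S`: in every weakly proper matrix convex combination of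
points of `S` that is equal to `X`, each of those points is unitarily equivalent to `X` or to a
direct sum `X ⊕ Z` with `Z` in `S`. -/
def IsAbsoluteExtremePoint (S : FreeSet d) {n : ℕ} (X : MatTuple d n) : Prop :=
  X ∈ S.level n ∧
    ∀ (k : ℕ) (s : Fin k → ℕ) (Y : ∀ i, MatTuple d (s i)) (V : ∀ i, Matrix (Fin (s i)) (Fin n) ℂ),
      S.IsMatrixConvexCombination X s Y V → (∀ i, V i ≠ 0) →
        ∀ i, (Y i).UnitarilyEquivalent X ∨
          ∃ (p : ℕ) (Z : MatTuple d p), Z ∈ S.level p ∧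
            (Y i).UnitarilyEquivalent (X.directSum Z)

/-- The closed matrix convex hull of `C`: the smallest closed matrix convex set containing `C`. -/
def closedMatrixConvexHull (C : FreeSet d) : FreeSet d where
  level n := {X | 0 < n ∧ ∀ T : FreeSet d, T.IsMatrixConvex → T.IsLevelwiseClosed →
    (∀ m, C.level m ⊆ T.level m) → X ∈ T.level n}
  level_zero := by
    ext X
    simp

/-- The set of all matrix extreme points of `S` that are not unitarily equivalent to `X`. -/
def otherMatrixExtremePoints (S : FreeSet d) {n : ℕ} (X : MatTuple d n) : FreeSet d where
  level m := {M | S.IsMatrixExtremePoint M ∧ ¬ M.UnitarilyEquivalent X}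
  level_zero := by
    ext M
    simp [IsMatrixExtremePoint, S.level_zero]

/-- `X` is a crucial matrix extreme point of `S`: it lies in `S`, but not in the closed matrix
convex hull of the matrix extreme points of `S` that are not unitarily equivalent to `X`. -/
def IsCrucialMatrixExtremePoint (S : FreeSet d) {n : ℕ} (X : MatTuple d n) : Prop :=
  X ∈ S.level n ∧ X ∉ (S.otherMatrixExtremePoints X).closedMatrixConvexHull.level n

end FreeSet

/-! Replace a tuple Z by (1, Z). The tuples R* (1, Z) R of a fixed size, with Z in S, form a convex
cone with compact base. Its extreme rays come from matrix extreme points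
(`extremePoints_coneBase_subset`), so Minkowski's theorem gives (1, Y) = ∑ W_l* (1, Z_l) W_l with
every Z_l matrix extreme, for each Y in S (`homog_mem_closure_extremeCone`).

Let X be crucial. Then X is matrix extreme, since otherwise all matrix extreme points would belong
to C, whose hull would be S. Let V* (1, Y) V be a nonzero summand of (1, X) and expand (1, Y) as
above. If W_l V ≠ 0, matrix extremality makes X an isometric compression of Z_l
(`IsMatrixExtremePoint.exists_isometry`); as X is outside the hull of C, Z_l is unitarily equivalent
to X, and one may take Z_l = X. Then W_l V is square, and matrix extremality forces it to be a
scalar c_l (`IsMatrixExtremePoint.exists_eq_smul_one`). Hence Y_j V = ∑ c_l W_l* X_j = V X_j,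
likewise for adjoints, and V* V = ∑ |c_l|² is scalar. A multiple of V is thus an isometry onto a
reducing subspace of Y on which Y acts as X, so X splits off from Y. -/

/-! ### Minkowski's theorem in finite dimension -/

/-- **Minkowski's theorem**: a compact convex set in a finite-dimensional space is the convex hull
of its extreme points. -/
theorem subset_convexHull_extremePoints_of_isCompact {E : Type*} [NormedAddCommGroup E] [NormedSpace ℝ E]
    [FiniteDimensional ℝ E] {A : Set E} (hA : IsCompact A) (hconv : Convex ℝ A) :
    A ⊆ convexHull ℝ (A.extremePoints ℝ) := by
  induction hn : Module.finrank ℝ E using Nat.strong_induction_on generalizing E with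
  | _ n ih =>
  -- A set on which a nonzero functional is constant is a translate of a subset of its kernel, where
  -- the induction hypothesis applies.
  have key : ∀ (B : Set E), IsCompact B → Convex ℝ B → ∀ f : E →ₗ[ℝ] ℝ, f ≠ 0 →
      ∀ x ∈ B, (∀ y ∈ B, f y = f x) → x ∈ convexHull ℝ (B.extremePoints ℝ) := by
    intro B hB hBc f hf x hx hfx
    let g : LinearMap.ker f →ᵃ[ℝ] E :=
      (LinearMap.ker f).subtype.toAffineMap + AffineMap.const ℝ _ x
    have hg : ∀ v, g v = v + x := fun v => rfl
    have hgi : Function.Injective g := fun v w h => by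
      simpa [hg] using h
    have hlt : Module.finrank ℝ (LinearMap.ker f) < n := by
      rw [← hn]
      refine Submodule.finrank_lt ?_
      rwa [Ne, LinearMap.ker_eq_top]
    have hgc : Topology.IsClosedEmbedding g := by
      have h1 : Topology.IsClosedEmbedding (Subtype.val : LinearMap.ker f → E) :=
        (LinearMap.ker f).closed_of_finiteDimensional.isClosedEmbedding_subtypeVal
      exact (Homeomorph.addRight x).isClosedEmbedding.comp h1
    have himg : g '' (g ⁻¹' B) = B := by
      rw [Set.image_preimage_eq_iff]
      intro y hy
      refine ⟨⟨y - x, ?_⟩, ?_⟩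
      · rw [LinearMap.mem_ker, map_sub, hfx y hy, sub_self]
      · simp [hg]
    have h0 := ih _ hlt (hgc.isCompact_preimage hB) (hBc.affine_preimage g) rfl
      (show (0 : LinearMap.ker f) ∈ g ⁻¹' B by simpa [hg] using hx)
    have h1 := Set.mem_image_of_mem g h0
    rw [AffineMap.image_convexHull] at h1
    rw [show g 0 = x by simp [hg]] at h1
    refine convexHull_mono ?_ h1
    rintro _ ⟨v, hv, rfl⟩
    refine ⟨hv.1, ?_⟩
    intro y hy z hz hyz
    rw [← himg] at hy hz
    obtain ⟨y, hy, rfl⟩ := hy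
    obtain ⟨z, hz, rfl⟩ := hz
    rw [← image_openSegment] at hyz
    obtain ⟨w, hw, hwv⟩ := hyz
    obtain rfl := hgi hwv
    rw [hv.2 hy hz hw]
  intro x hx
  by_cases hint : (interior A).Nonempty
  · by_cases hxi : x ∈ interior A
    -- By Krein–Milman the hull of the extreme points is dense in A; it has full affine span because
    -- affine subspaces are closed, and a convex set with nonempty interior has the same interior as
    -- its closure.
    · have hcl := closure_convexHull_extremePoints hA hconv
      have hC : (interior (convexHull ℝ (A.extremePoints ℝ))).Nonempty := by
        rw [(convex_convexHull ℝ _).interior_nonempty_iff_affineSpan_eq_top, eq_top_iff]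
        have h1 := hconv.interior_nonempty_iff_affineSpan_eq_top.1 hint
        rw [← h1, affineSpan_le]
        conv_lhs => rw [← hcl]
        exact closure_minimal (subset_affineSpan ℝ _)
          (AffineSubspace.closed_of_finiteDimensional _)
      have h2 := (convex_convexHull ℝ
        (A.extremePoints ℝ)).interior_closure_eq_interior_of_nonempty_interior hC
      rw [hcl] at h2
      rw [h2] at hxi
      exact interior_subset hxi
    -- A supporting hyperplane at the boundary point x cuts out an exposed face, to which `key`
    -- applies.
    · obtain ⟨f, hf⟩ := geometric_hahn_banach_open_point hconv.interior isOpen_interior hxi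
      have hle : ∀ a ∈ A, f a ≤ f x := by
        intro a ha
        have : a ∈ closure (interior A) := by
          rw [hconv.closure_interior_eq_closure_of_nonempty_interior hint]
          exact subset_closure ha
        exact closure_minimal (fun a ha => (hf a ha).le)
          (isClosed_le f.continuous continuous_const) this
      have hexp : IsExposed ℝ A {y ∈ A | ∀ z ∈ A, f z ≤ f y} := fun _ => ⟨f, rfl⟩
      have hf0 : (f : E →ₗ[ℝ] ℝ) ≠ 0 := by
        rintro h
        obtain ⟨a, ha⟩ := hint
        have h1 := hf a ha
        have h2 : ∀ y, f y = 0 := fun y => LinearMap.congr_fun h y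
        simp [h2] at h1
      have := key _ (hexp.isCompact hA) (hexp.convex hconv) (f : E →ₗ[ℝ] ℝ) hf0 x ⟨hx, hle⟩
        (fun y hy => le_antisymm (hle y hy.1) (hy.2 x hx))
      exact convexHull_mono hexp.isExtreme.extremePoints_subset_extremePoints this
  · rw [hconv.interior_nonempty_iff_affineSpan_eq_top] at hint
    obtain ⟨f, hf, hfm⟩ : ∃ f : E →ₗ[ℝ] ℝ, f ≠ 0 ∧ vectorSpan ℝ A ≤ LinearMap.ker f := by
      have : vectorSpan ℝ A ≠ ⊤ := by
        intro h
        exact hint ((AffineSubspace.affineSpan_eq_top_iff_vectorSpan_eq_top_of_nonempty ℝ E E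
          ⟨x, hx⟩).2 h)
      obtain ⟨f, hf, h⟩ := Submodule.exists_le_ker_of_lt_top _ (lt_top_iff_ne_top.2 this)
      exact ⟨f, hf, h⟩
    refine key A hA hconv f hf x hx fun y hy => ?_
    have := hfm (vsub_mem_vectorSpan ℝ hy hx)
    rw [LinearMap.mem_ker, vsub_eq_sub, map_sub] at this
    linarith

/-! ### Compressions are completely positive -/

section
open scoped MatrixOrder Matrix.Norms.L2Operator CStarAlgebra

/-- The square matrix whose first row is the `r`-th row of `C`, all other rows being zero. -/
def rowMatrix {m n : ℕ} (hn : 0 < n) (r : Fin m) (C : Matrix (Fin m) (Fin n) ℂ) :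
    Matrix (Fin n) (Fin n) ℂ :=
  Matrix.of fun a b => if a = ⟨0, hn⟩ then C r b else 0

theorem conjTranspose_mul_eq_sum_rowMatrix {m n : ℕ} (hn : 0 < n)
    (C D : Matrix (Fin m) (Fin n) ℂ) :
    Cᴴ * D = ∑ r, (rowMatrix hn r C)ᴴ * rowMatrix hn r D := by
  ext a b
  simp only [Matrix.sum_apply]
  simp only [rowMatrix, Matrix.mul_apply, Matrix.conjTranspose_apply, Matrix.of_apply]
  refine Finset.sum_congr rfl fun r _ => ?_
  rw [Finset.sum_eq_single ⟨0, hn⟩] <;> simp +contextual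

/-- The products `C l * W` are rectangular, whereas a positive element over M_n must be a sum of
squares with n × n entries. Splitting them into single rows, each placed in a square matrix, repairs
this. -/
theorem compression_sum_eq_sum_rowMatrix {m n k : ℕ} (hn : 0 < n) (W : Matrix (Fin m) (Fin n) ℂ)
    (C D : Fin k → Matrix (Fin m) (Fin m) ℂ) :
    Wᴴ * (∑ l, (C l)ᴴ * D l) * W =
      ∑ r, ∑ l, (rowMatrix hn r (C l * W))ᴴ * rowMatrix hn r (D l * W) := by
  rw [Matrix.mul_sum, Matrix.sum_mul, Finset.sum_comm]
  refine Finset.sum_congr rfl fun l _ => ?_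
  rw [← conjTranspose_mul_eq_sum_rowMatrix, Matrix.conjTranspose_mul]
  simp only [Matrix.mul_assoc]

theorem CStarMatrix.finset_sum_apply {ι m n A : Type*} [AddCommMonoid A] (s : Finset ι)
    (F : ι → CStarMatrix m n A) (i : m) (j : n) : (∑ r ∈ s, F r) i j = ∑ r ∈ s, F r i j := by
  classical
  induction s using Finset.induction_on with
  | empty => rfl
  | insert a s ha ih => rw [Finset.sum_insert ha, Finset.sum_insert ha, ← ih]; rfl

/-- The completely positive map `A ↦ W* A W`. -/
noncomputable def compressionCP {m n : ℕ} (hn : 0 < n) (W : Matrix (Fin m) (Fin n) ℂ) :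
    Matrix (Fin m) (Fin m) ℂ →CP Matrix (Fin n) (Fin n) ℂ where
  toFun A := Wᴴ * A * W
  map_add' A B := by rw [Matrix.mul_add, Matrix.add_mul]
  map_smul' c A := by simp
  map_cstarMatrix_nonneg' k M hM := by
    change 0 ≤ M.map (fun A : Matrix (Fin m) (Fin m) ℂ => Wᴴ * A * W)
    rw [StarOrderedRing.nonneg_iff] at hM
    induction hM using AddSubmonoid.closure_induction with
    | mem M hM =>
      obtain ⟨B, rfl⟩ := hM
      let F : Fin m → CStarMatrix (Fin k) (Fin k) (Matrix (Fin n) (Fin n) ℂ) := fun r =>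
        CStarMatrix.ofMatrix (Matrix.of fun l j => rowMatrix hn r (B l j * W))
      have : (star B * B).map (fun A : Matrix (Fin m) (Fin m) ℂ => Wᴴ * A * W)
          = ∑ r, star (F r) * F r := by
        refine CStarMatrix.ext fun i j => ?_
        rw [CStarMatrix.finset_sum_apply]
        simp only [CStarMatrix.mul_apply, CStarMatrix.map_apply]
        exact compression_sum_eq_sum_rowMatrix hn W (fun l => B l i) (fun l => B l j)
      change 0 ≤ (star B * B).map (fun A : Matrix (Fin m) (Fin m) ℂ => Wᴴ * A * W)
      rw [this]
      exact Finset.sum_nonneg fun r _ => star_mul_self_nonneg _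
    | zero =>
      refine le_of_eq ?_
      refine CStarMatrix.ext fun i j => ?_
      change 0 = Wᴴ * (0 : Matrix (Fin m) (Fin m) ℂ) * W
      simp
    | add M N _ _ hM hN =>
      refine (add_nonneg hM hN).trans_eq ?_
      refine CStarMatrix.ext fun i j => ?_
      change Wᴴ * M i j * W + Wᴴ * N i j * W = Wᴴ * (M i j + N i j) * W
      rw [Matrix.mul_add, Matrix.add_mul]

theorem compressionCP_apply {m n : ℕ} (hn : 0 < n) (W : Matrix (Fin m) (Fin n) ℂ)
    (A : Matrix (Fin m) (Fin m) ℂ) : compressionCP hn W A = Wᴴ * A * W := rfl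

theorem FreeSet.ClosedUnderUCP.compression_mem {d : ℕ} {S : FreeSet d} (hS : S.ClosedUnderUCP)
    {m n : ℕ} (hn : 0 < n) {X : MatTuple d m} (hX : X ∈ S.level m) (W : Matrix (Fin m) (Fin n) ℂ)
    (hW : Wᴴ * W = 1) : (fun j => Wᴴ * X j * W) ∈ S.level n := by
  have hm : 0 < m := by
    rcases Nat.eq_zero_or_pos m with rfl | h
    · simp [S.level_zero] at hX
    · exact h
  have h := hS m n hm hn (compressionCP hn W) (by
    rw [compressionCP_apply, Matrix.mul_one, hW]) X hX
  simpa only [compressionCP_apply] using h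

end

/-! ### Homogenised tuples and conjugation -/

namespace MatTuple

variable {d : ℕ}

/-- The homogenisation `(1, X_1, …, X_d)` of a matrix tuple `X`. -/
def homog {n : ℕ} (X : MatTuple d n) : Option (Fin d) → Matrix (Fin n) (Fin n) ℂ :=
  fun o => o.elim 1 X

@[simp] theorem homog_none {n : ℕ} (X : MatTuple d n) : X.homog none = 1 := rfl

@[simp] theorem homog_some {n : ℕ} (X : MatTuple d n) (j : Fin d) : X.homog (some j) = X j := rfl

end MatTuple

/-- The tuple `V* A V`. -/
def conjTuple {ι : Type*} {m n : ℕ} (V : Matrix (Fin m) (Fin n) ℂ)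
    (A : ι → Matrix (Fin m) (Fin m) ℂ) : ι → Matrix (Fin n) (Fin n) ℂ :=
  fun o => Vᴴ * A o * V

section conjTuple

variable {ι : Type*} {m n k : ℕ}

theorem conjTuple_apply (V : Matrix (Fin m) (Fin n) ℂ) (A : ι → Matrix (Fin m) (Fin m) ℂ) (o : ι) :
    conjTuple V A o = Vᴴ * A o * V := rfl

theorem conjTranspose_conjTuple_apply (V : Matrix (Fin m) (Fin n) ℂ)
    (A : ι → Matrix (Fin m) (Fin m) ℂ) (o : ι) : (conjTuple V A o)ᴴ = Vᴴ * (A o)ᴴ * V := by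
  simp only [conjTuple_apply, Matrix.conjTranspose_mul, Matrix.conjTranspose_conjTranspose,
    Matrix.mul_assoc]

theorem conjTuple_conjTuple (V : Matrix (Fin m) (Fin n) ℂ) (W : Matrix (Fin k) (Fin m) ℂ)
    (A : ι → Matrix (Fin k) (Fin k) ℂ) : conjTuple V (conjTuple W A) = conjTuple (W * V) A := by
  funext o
  simp only [conjTuple_apply, Matrix.conjTranspose_mul, Matrix.mul_assoc]

theorem conjTuple_add (V : Matrix (Fin m) (Fin n) ℂ) (A B : ι → Matrix (Fin m) (Fin m) ℂ) :
    conjTuple V (A + B) = conjTuple V A + conjTuple V B := by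
  funext o
  simp only [conjTuple_apply, Pi.add_apply, Matrix.mul_add, Matrix.add_mul]

theorem conjTuple_sum {κ : Type*} (V : Matrix (Fin m) (Fin n) ℂ) (s : Finset κ)
    (A : κ → ι → Matrix (Fin m) (Fin m) ℂ) :
    conjTuple V (∑ i ∈ s, A i) = ∑ i ∈ s, conjTuple V (A i) := by
  funext o
  simp only [conjTuple_apply, Finset.sum_apply, Matrix.mul_sum, Matrix.sum_mul]

theorem conjTuple_smul (V : Matrix (Fin m) (Fin n) ℂ) (t : ℝ) (A : ι → Matrix (Fin m) (Fin m) ℂ) :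
    conjTuple V (t • A) = t • conjTuple V A := by
  funext o
  simp only [conjTuple_apply, Pi.smul_apply, Matrix.mul_smul, Matrix.smul_mul]

@[simp] theorem conjTuple_zero_left (A : ι → Matrix (Fin m) (Fin m) ℂ) :
    conjTuple (0 : Matrix (Fin m) (Fin n) ℂ) A = 0 := by
  funext o
  simp [conjTuple_apply]

@[simp] theorem conjTuple_one (A : ι → Matrix (Fin m) (Fin m) ℂ) : conjTuple 1 A = A := by
  funext o
  simp [conjTuple_apply]

theorem conjTuple_sqrt_smul (V : Matrix (Fin m) (Fin n) ℂ) {t : ℝ} (ht : 0 ≤ t)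
    (A : ι → Matrix (Fin m) (Fin m) ℂ) :
    conjTuple (Real.sqrt t • V) A = t • conjTuple V A := by
  funext o
  simp only [conjTuple_apply, Matrix.conjTranspose_smul, Pi.smul_apply, Matrix.smul_mul,
    Matrix.mul_smul, smul_smul, star_trivial, Real.mul_self_sqrt ht]

theorem MatTuple.homog_compression {d : ℕ} (X : MatTuple d m) {V : Matrix (Fin m) (Fin n) ℂ}
    (hV : Vᴴ * V = 1) : MatTuple.homog (fun j => Vᴴ * X j * V) = conjTuple V X.homog := by
  funext o
  cases o <;> simp [conjTuple_apply, hV]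

end conjTuple

/-- The columns of T are an orthonormal basis of the range of V, and D = T* V. This turns a nonzero
coefficient into one of full row rank, as proper combinations require. -/
theorem Matrix.exists_isometry_mul {k m : ℕ} (V : Matrix (Fin k) (Fin m) ℂ) :
    ∃ (r : ℕ) (T : Matrix (Fin k) (Fin r) ℂ) (D : Matrix (Fin r) (Fin m) ℂ),
      Tᴴ * T = 1 ∧ V = T * D ∧ D.rank = r ∧ V.rank = r := by
  let U := LinearMap.range (Matrix.toEuclideanLin V)
  let b := stdOrthonormalBasis ℂ U
  let T : Matrix (Fin k) (Fin (Module.finrank ℂ U)) ℂ :=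
    Matrix.of fun a j => (b j : EuclideanSpace ℂ (Fin k)) a
  have hT : Tᴴ * T = 1 := by
    ext i j
    have h := orthonormal_iff_ite.1 b.orthonormal i j
    rw [Submodule.coe_inner, PiLp.inner_apply] at h
    rw [Matrix.one_apply, ← h]
    simp [T, Matrix.mul_apply, mul_comm]
  have hV : V = T * (Tᴴ * V) := by
    ext a c
    let v : U := ⟨Matrix.toEuclideanLin V (EuclideanSpace.single c 1), ⟨_, rfl⟩⟩
    have hv : ∀ a, (v : EuclideanSpace ℂ (Fin k)) a = V a c := fun a => by
      simp [v, Matrix.toEuclideanLin]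
    have h := congrArg (fun w : U => (w : EuclideanSpace ℂ (Fin k)) a) (b.sum_repr' v)
    simp only [hv] at h
    rw [← h, Matrix.mul_apply]
    simp [T, Matrix.mul_apply, PiLp.inner_apply, hv, mul_comm]
  have hr : V.rank = Module.finrank ℂ U := by
    rw [Matrix.rank_eq_finrank_range_toLin V (EuclideanSpace.basisFun _ ℂ).toBasis
      (EuclideanSpace.basisFun _ ℂ).toBasis, ← Matrix.toEuclideanLin_eq_toLin_orthonormal]
  refine ⟨_, T, Tᴴ * V, hT, hV, le_antisymm (Matrix.rank_le_height _) ?_, hr⟩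
  conv_lhs => rw [← hr, hV]
  exact Matrix.rank_mul_le_right _ _

/-! ### The cone of a matrix convex set -/

namespace FreeSet

variable {d : ℕ}

theorem pos_of_mem_level {S : FreeSet d} {n : ℕ} {X : MatTuple d n} (hX : X ∈ S.level n) :
    0 < n := by
  rcases Nat.eq_zero_or_pos n with rfl | h
  · simp [S.level_zero] at hX
  · exact h

/-- The tuples `R* (1, Z) R` with `Z` in `S` and `R` an arbitrary matrix. -/
def cone (S : FreeSet d) (n : ℕ) : Set (Option (Fin d) → Matrix (Fin n) (Fin n) ℂ) :=
  {A | ∃ (N : ℕ) (Z : MatTuple d N) (R : Matrix (Fin N) (Fin n) ℂ),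
    Z ∈ S.level N ∧ A = conjTuple R Z.homog}

variable {S : FreeSet d} {m n : ℕ}

theorem conjTuple_homog_mem_cone {Z : MatTuple d m} (hZ : Z ∈ S.level m)
    (R : Matrix (Fin m) (Fin n) ℂ) : conjTuple R Z.homog ∈ S.cone n :=
  ⟨m, Z, R, hZ, rfl⟩

theorem homog_mem_cone_of_mem {Z : MatTuple d n} (hZ : Z ∈ S.level n) : Z.homog ∈ S.cone n :=
  ⟨n, Z, 1, hZ, by simp⟩

theorem conjTuple_mem_cone {A : Option (Fin d) → Matrix (Fin m) (Fin m) ℂ} (hA : A ∈ S.cone m)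
    (V : Matrix (Fin m) (Fin n) ℂ) : conjTuple V A ∈ S.cone n := by
  obtain ⟨N, Z, R, hZ, rfl⟩ := hA
  rw [conjTuple_conjTuple]
  exact conjTuple_homog_mem_cone hZ _

theorem zero_mem_cone {Z : MatTuple d m} (hZ : Z ∈ S.level m) : 0 ∈ S.cone n :=
  ⟨m, Z, 0, hZ, by simp⟩

theorem smul_mem_cone {A : Option (Fin d) → Matrix (Fin n) (Fin n) ℂ} (hA : A ∈ S.cone n)
    {t : ℝ} (ht : 0 ≤ t) : t • A ∈ S.cone n := by
  obtain ⟨N, Z, R, hZ, rfl⟩ := hA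
  rw [← conjTuple_sqrt_smul _ ht]
  exact conjTuple_homog_mem_cone hZ _

theorem _root_.MatTuple.homog_directSum (X : MatTuple d m) (Y : MatTuple d n)
    (o : Option (Fin d)) : (X.directSum Y).homog o = Matrix.reindex finSumFinEquiv finSumFinEquiv
      (Matrix.fromBlocks (X.homog o) 0 0 (Y.homog o)) := by
  cases o with
  | none => simp [Matrix.fromBlocks_one]
  | some j => rfl

theorem _root_.conjTuple_homog_directSum {k : ℕ} (X : MatTuple d m) (Y : MatTuple d n)
    (R : Matrix (Fin m) (Fin k) ℂ) (Q : Matrix (Fin n) (Fin k) ℂ) :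
    conjTuple (Matrix.reindex finSumFinEquiv (Equiv.refl _) (Matrix.fromRows R Q))
      (X.directSum Y).homog = conjTuple R X.homog + conjTuple Q Y.homog := by
  funext o
  simp only [conjTuple_apply, MatTuple.homog_directSum, Pi.add_apply, Matrix.reindex_apply,
    Matrix.conjTranspose_submatrix, Matrix.submatrix_mul_equiv,
    Matrix.conjTranspose_fromRows_eq_fromCols_conjTranspose, Matrix.fromCols_mul_fromBlocks,
    Matrix.fromCols_mul_fromRows]
  simp

/-- Stack the two coefficient matrices and take the direct sum of the two points. -/
theorem add_mem_cone (hS : S.IsMatrixConvex) {A B : Option (Fin d) → Matrix (Fin n) (Fin n) ℂ}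
    (hA : A ∈ S.cone n) (hB : B ∈ S.cone n) : A + B ∈ S.cone n := by
  obtain ⟨N, Z, R, hZ, rfl⟩ := hA
  obtain ⟨M, Y, Q, hY, rfl⟩ := hB
  exact ⟨N + M, Z.directSum Y, _, hS.1 _ _ _ hZ _ hY, (conjTuple_homog_directSum Z Y R Q).symm⟩

theorem sum_mem_cone (hS : S.IsMatrixConvex) (h0 : (0 : Option (Fin d) → Matrix _ _ ℂ) ∈ S.cone n)
    {κ : Type*} (s : Finset κ) {A : κ → Option (Fin d) → Matrix (Fin n) (Fin n) ℂ}
    (hA : ∀ i ∈ s, A i ∈ S.cone n) : ∑ i ∈ s, A i ∈ S.cone n := by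
  classical
  induction s using Finset.induction_on with
  | empty => simpa using h0
  | insert a s ha ih =>
    rw [Finset.sum_insert ha]
    exact add_mem_cone hS (hA a (Finset.mem_insert_self _ _))
      (ih fun i hi => hA i (Finset.mem_insert_of_mem hi))

theorem compression_mem (hS : S.IsMatrixConvex) (hn : 0 < n) {Z : MatTuple d m}
    (hZ : Z ∈ S.level m) {V : Matrix (Fin m) (Fin n) ℂ} (hV : Vᴴ * V = 1) :
    (fun j => Vᴴ * Z j * V) ∈ S.level n :=
  hS.2.compression_mem hn hZ V hV

/-- The leading entry 1 forces R to be an isometry, so passing to the cone loses nothing. -/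
theorem mem_of_homog_mem_cone (hS : S.IsMatrixConvex) (hn : 0 < n) {X : MatTuple d n}
    (hX : X.homog ∈ S.cone n) : X ∈ S.level n := by
  obtain ⟨N, Z, R, hZ, h⟩ := hX
  have h0 : Rᴴ * R = 1 := by simpa [conjTuple_apply] using (congrFun h none).symm
  have h1 : X = fun j => Rᴴ * Z j * R := funext fun j => congrFun h (some j)
  rw [h1]
  exact compression_mem hS hn hZ h0

/-- Every element `R* (1, Z) R` of the cone can be written with `R` of full row rank. -/
theorem exists_rank_eq_of_mem_cone (hS : S.IsMatrixConvex) (V : Matrix (Fin m) (Fin n) ℂ)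
    (hV : V ≠ 0) {Z : MatTuple d m} (hZ : Z ∈ S.level m) :
    ∃ (r : ℕ) (T : Matrix (Fin m) (Fin r) ℂ) (D : Matrix (Fin r) (Fin n) ℂ),
      Tᴴ * T = 1 ∧ V = T * D ∧ D.rank = r ∧ V.rank = r ∧ (fun j => Tᴴ * Z j * T) ∈ S.level r ∧
      conjTuple D (MatTuple.homog fun j => Tᴴ * Z j * T) = conjTuple V Z.homog := by
  obtain ⟨r, T, D, hT, rfl, hD, hr⟩ := Matrix.exists_isometry_mul V
  have hpos : 0 < r := by
    rcases Nat.eq_zero_or_pos r with rfl | h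
    · exact absurd (by ext; simp [Matrix.mul_apply]) hV
    · exact h
  refine ⟨r, T, D, hT, rfl, hD, hr, compression_mem hS hpos hZ hT, ?_⟩
  rw [Z.homog_compression hT, conjTuple_conjTuple]

theorem isMatrixConvexCombination_iff {X : MatTuple d n} {k : ℕ} {s : Fin k → ℕ}
    {Y : ∀ i, MatTuple d (s i)} {V : ∀ i, Matrix (Fin (s i)) (Fin n) ℂ} :
    S.IsMatrixConvexCombination X s Y V ↔
      (∀ i, Y i ∈ S.level (s i)) ∧ X.homog = ∑ i, conjTuple (V i) (Y i).homog := by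
  refine and_congr_right fun _ => ⟨fun h => ?_, fun h => ⟨?_, fun j => ?_⟩⟩
  · funext o
    rw [Finset.sum_apply]
    cases o with
    | none => simpa [conjTuple_apply] using h.1.symm
    | some j => simpa [conjTuple_apply] using h.2 j
  · have := congrFun h none
    rw [Finset.sum_apply] at this
    simpa [conjTuple_apply] using this.symm
  · have := congrFun h (some j)
    rw [Finset.sum_apply] at this
    simpa [conjTuple_apply] using this

end FreeSet

/-! ### Unitary equivalence -/

namespace MatTuple.UnitarilyEquivalent

variable {d m n k : ℕ} {X : MatTuple d m} {Y : MatTuple d n} {Z : MatTuple d k}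

theorem symm (h : X.UnitarilyEquivalent Y) : Y.UnitarilyEquivalent X := by
  obtain ⟨U, h1, h2, h⟩ := h
  refine ⟨Uᴴ, by simpa using h2, by simpa using h1, fun j => ?_⟩
  calc X j = (U * Uᴴ) * X j * (U * Uᴴ) := by simp [h2]
    _ = _ := by simp only [h, Matrix.conjTranspose_conjTranspose, Matrix.mul_assoc]

theorem trans (hXY : X.UnitarilyEquivalent Y) (hYZ : Y.UnitarilyEquivalent Z) :
    X.UnitarilyEquivalent Z := by
  obtain ⟨U, hU1, hU2, hU⟩ := hXY
  obtain ⟨W, hW1, hW2, hW⟩ := hYZ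
  refine ⟨U * W, ?_, ?_, fun j => ?_⟩
  · rw [Matrix.conjTranspose_mul, Matrix.mul_assoc, ← Matrix.mul_assoc Uᴴ, hU1, Matrix.one_mul, hW1]
  · rw [Matrix.conjTranspose_mul, Matrix.mul_assoc, ← Matrix.mul_assoc W, hW2, Matrix.one_mul, hU2]
  · simp only [hW, hU, Matrix.conjTranspose_mul, Matrix.mul_assoc]

theorem size_eq (h : X.UnitarilyEquivalent Y) : m = n := by
  obtain ⟨U, h1, h2, -⟩ := h
  have a : (1 : Matrix (Fin n) (Fin n) ℂ).rank ≤ U.rank := by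
    rw [← h1]
    exact Matrix.rank_mul_le_right _ _
  have b : (1 : Matrix (Fin m) (Fin m) ℂ).rank ≤ U.rank := by
    rw [← h2]
    exact Matrix.rank_mul_le_left _ _
  rw [Matrix.rank_one, Fintype.card_fin] at a b
  have := U.rank_le_height
  have := U.rank_le_width
  omega

end MatTuple.UnitarilyEquivalent

/-! ### Summands of a matrix extreme point -/

namespace FreeSet

variable {d : ℕ} {S : FreeSet d} {m n : ℕ}

theorem IsMatrixExtremePoint.of_unitarilyEquivalent (hS : S.IsMatrixConvex) {X : MatTuple d m}
    {Y : MatTuple d n} (hX : S.IsMatrixExtremePoint X) (h : X.UnitarilyEquivalent Y) :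
    S.IsMatrixExtremePoint Y := by
  obtain rfl := h.size_eq
  have hm := pos_of_mem_level hX.1
  obtain ⟨U, hU1, hU2, hU⟩ := id h
  have hY : Y = fun j => Uᴴ * X j * U := funext hU
  refine ⟨hY ▸ compression_mem hS hm hX.1 hU1, fun k s Z V hc hr i => ?_⟩
  rw [isMatrixConvexCombination_iff] at hc
  refine MatTuple.UnitarilyEquivalent.trans (hX.2 k s Z (fun i => V i * Uᴴ) ?_ ?_ i) h
  · rw [isMatrixConvexCombination_iff]
    refine ⟨hc.1, ?_⟩
    have h1 : X.homog = conjTuple Uᴴ Y.homog := by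
      rw [hY, X.homog_compression hU1, conjTuple_conjTuple, hU2, conjTuple_one]
    rw [h1, hc.2, conjTuple_sum]
    simp only [conjTuple_conjTuple]
  · intro i
    refine (Matrix.rank_mul_eq_left_of_isUnit_det _ _ ?_).trans (hr i)
    rw [← Matrix.isUnit_iff_isUnit_det]
    exact IsUnit.of_mul_eq_one U hU1

/-- A nonzero summand of a matrix extreme point compresses to that point. -/
theorem IsMatrixExtremePoint.exists_isometry (hS : S.IsMatrixConvex) {X : MatTuple d n}
    (hX : S.IsMatrixExtremePoint X) {Y : MatTuple d m} (hY : Y ∈ S.level m)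
    {V : Matrix (Fin m) (Fin n) ℂ} (hV : V ≠ 0)
    {B : Option (Fin d) → Matrix (Fin n) (Fin n) ℂ} (hB : B ∈ S.cone n)
    (h : X.homog = conjTuple V Y.homog + B) :
    V.rank = n ∧ ∃ T : Matrix (Fin m) (Fin n) ℂ, Tᴴ * T = 1 ∧ X.homog = conjTuple T Y.homog := by
  -- Reducing both summands to coefficients of full row rank gives a proper combination of two
  -- points, or of one when the remainder vanishes.
  obtain ⟨r, T, D, hT, -, hD, hr, hTY, hDT⟩ := exists_rank_eq_of_mem_cone hS V hV hY
  have key : MatTuple.UnitarilyEquivalent (fun j => Tᴴ * Y j * T) X := by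
    obtain ⟨N, Z, R, hZ, rfl⟩ := hB
    by_cases hR : R = 0
    · refine hX.2 1 (fun _ => r) (fun _ => fun j => Tᴴ * Y j * T) (fun _ => D) ?_
        (fun _ => hD) 0
      rw [isMatrixConvexCombination_iff]
      refine ⟨fun _ => hTY, ?_⟩
      simp [h, hR, hDT]
    · obtain ⟨q, T', D', -, -, hD', -, hTZ, hDZ⟩ := exists_rank_eq_of_mem_cone hS R hR hZ
      let P : Fin 2 → Σ s, MatTuple d s × Matrix (Fin s) (Fin n) ℂ :=
        ![⟨r, fun j => Tᴴ * Y j * T, D⟩, ⟨q, fun j => T'ᴴ * Z j * T', D'⟩]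
      refine hX.2 2 (fun i => (P i).1) (fun i => (P i).2.1) (fun i => (P i).2.2) ?_ ?_ 0
      · rw [isMatrixConvexCombination_iff, Fin.forall_fin_two, Fin.sum_univ_two]
        exact ⟨⟨hTY, hTZ⟩, h.trans (congrArg₂ (· + ·) hDT.symm hDZ.symm)⟩
      · rw [Fin.forall_fin_two]
        exact ⟨hD, hD'⟩
  obtain rfl := key.size_eq
  obtain ⟨U, hU1, -, hU⟩ := key
  refine ⟨hr, T * U, ?_, ?_⟩
  · rw [Matrix.conjTranspose_mul, Matrix.mul_assoc, ← Matrix.mul_assoc Tᴴ, hT, Matrix.one_mul, hU1]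
  · rw [← conjTuple_conjTuple, ← Y.homog_compression hT, ← MatTuple.homog_compression _ hU1]
    exact congrArg MatTuple.homog (funext hU)

/-- For an eigenvalue c of V, averaging the decomposition with X itself makes a multiple of c - V
the coefficient of a summand of X. If V ≠ c this summand is nonzero, so c - V has rank n by
`exists_isometry`, which contradicts the choice of c. -/
theorem IsMatrixExtremePoint.exists_eq_smul_one (hS : S.IsMatrixConvex) {X : MatTuple d n}
    (hX : S.IsMatrixExtremePoint X) {V : Matrix (Fin n) (Fin n) ℂ}
    {B : Option (Fin d) → Matrix (Fin n) (Fin n) ℂ} (hB : B ∈ S.cone n)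
    (h : X.homog = conjTuple V X.homog + B) : ∃ c : ℂ, V = c • (1 : Matrix (Fin n) (Fin n) ℂ) := by
  have hn := pos_of_mem_level hX.1
  have : Nonempty (Fin n) := ⟨⟨0, hn⟩⟩
  obtain ⟨c, hc⟩ := spectrum.nonempty_of_isAlgClosed_of_finiteDimensional ℂ V
  rw [spectrum.mem_iff] at hc
  refine ⟨c, ?_⟩
  by_contra hne
  -- The identity used is (c - V)* A (c - V) + (c̄V + 1)* A (c̄V + 1) = (1 + |c|²)(V* A V + A); the
  -- factor 2 comes from the averaging.
  let N : ℝ := 2 * (1 + Complex.normSq c)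
  have hN : 0 < N := by have := Complex.normSq_nonneg c; positivity
  let U : Matrix (Fin n) (Fin n) ℂ := Real.sqrt N⁻¹ • (algebraMap ℂ _ c - V)
  let W : Matrix (Fin n) (Fin n) ℂ := Real.sqrt N⁻¹ • ((starRingEnd ℂ c) • V + 1)
  have hs : Real.sqrt N⁻¹ ≠ 0 := (Real.sqrt_pos.2 (inv_pos.2 hN)).ne'
  have hU : U ≠ 0 := by
    refine smul_ne_zero hs ?_
    rw [sub_ne_zero, Algebra.algebraMap_eq_smul_one]
    exact fun h => hne h.symm
  have hsum : X.homog = conjTuple U X.homog + (conjTuple W X.homog + (1 / 2 : ℝ) • B) := by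
    have h1 : conjTuple U X.homog + conjTuple W X.homog
        = (1 / 2 : ℝ) • (conjTuple V X.homog + X.homog) := by
      rw [conjTuple_sqrt_smul _ (inv_pos.2 hN).le, conjTuple_sqrt_smul _ (inv_pos.2 hN).le,
        ← smul_add]
      have h2 : conjTuple (algebraMap ℂ _ c - V) X.homog +
          conjTuple ((starRingEnd ℂ c) • V + 1) X.homog
          = (1 + Complex.normSq c) • (conjTuple V X.homog + X.homog) := by
        funext o
        have h3 : ((1 + Complex.normSq c : ℝ) : ℂ) = 1 + c * starRingEnd ℂ c := by
          rw [Complex.mul_conj]; push_cast; rfl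
        simp only [Pi.add_apply, Pi.smul_apply, conjTuple_apply, ← Complex.coe_smul, h3,
          Algebra.algebraMap_eq_smul_one]
        simp only [Matrix.conjTranspose_sub, Matrix.conjTranspose_add, Matrix.conjTranspose_smul,
          Matrix.conjTranspose_one, sub_mul, add_mul, mul_sub, mul_add, Matrix.smul_mul,
          Matrix.mul_smul, Matrix.one_mul, Matrix.mul_one, RCLike.star_def, Complex.conj_conj]
        module
      rw [h2, smul_smul]
      congr 1
      simp only [N]
      have : 1 + Complex.normSq c ≠ 0 := by have := Complex.normSq_nonneg c; positivity
      field_simp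
    rw [← add_assoc, h1, ← smul_add, add_right_comm, ← h, smul_add, ← add_smul]
    norm_num
  have hr := (hX.exists_isometry hS hX.1 hU
    (add_mem_cone hS (conjTuple_homog_mem_cone hX.1 _) (smul_mem_cone hB (by norm_num))) hsum).1
  refine hc ?_
  have hUu : IsUnit U := by
    rw [← Matrix.mulVec_surjective_iff_isUnit]
    have : LinearMap.range U.mulVecLin = ⊤ := by
      apply Submodule.eq_top_of_finrank_eq
      simpa [Matrix.rank] using hr
    exact LinearMap.range_eq_top.1 this
  have : algebraMap ℂ _ c - V = (Real.sqrt N⁻¹)⁻¹ • U := by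
    rw [smul_smul, inv_mul_cancel₀ hs, one_smul]
  rw [this]
  exact hUu.smul (Units.mk0 _ (inv_ne_zero hs))

end FreeSet

/-! ### Compact base of the cone and its extreme points -/

theorem Matrix.exists_mul_eq_one_of_rank_eq {r n : ℕ} {D : Matrix (Fin r) (Fin n) ℂ}
    (hD : D.rank = r) : ∃ E : Matrix (Fin n) (Fin r) ℂ, D * E = 1 := by
  refine Matrix.mulVec_surjective_iff_exists_right_inverse.1 ?_
  have : LinearMap.range D.mulVecLin = ⊤ := by
    apply Submodule.eq_top_of_finrank_eq
    simpa [Matrix.rank] using hD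
  exact LinearMap.range_eq_top.1 this

namespace FreeSet

variable {d : ℕ} {S : FreeSet d} {m n : ℕ}

/-- Elements of the cone at level `n` come from points of size `n`. -/
theorem exists_square_of_mem_cone (hS : S.IsMatrixConvex) {Y : MatTuple d n} (hY : Y ∈ S.level n)
    {A : Option (Fin d) → Matrix (Fin n) (Fin n) ℂ} (hA : A ∈ S.cone n) :
    ∃ Z ∈ S.level n, ∃ R : Matrix (Fin n) (Fin n) ℂ, A = conjTuple R Z.homog := by
  obtain ⟨N, Z, R, hZ, rfl⟩ := hA
  by_cases hR : R = 0
  · exact ⟨Y, hY, 0, by simp [hR]⟩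
  obtain ⟨r, T, D, -, -, -, hr, hTZ, hD⟩ := exists_rank_eq_of_mem_cone hS R hR hZ
  rw [← hD]
  have hrn : r ≤ n := hr ▸ R.rank_le_width
  obtain ⟨c, rfl⟩ := Nat.exists_eq_add_of_le hrn
  -- A point of size r < n is padded to size n by a compression of Y, which receives the coefficient
  -- 0.
  rcases Nat.eq_zero_or_pos c with rfl | hc
  · exact ⟨_, hTZ, D, rfl⟩
  · let V : Matrix (Fin (r + c)) (Fin c) ℂ := (1 : Matrix _ _ ℂ).submatrix id (Fin.natAdd r)
    have hV : Vᴴ * V = 1 := by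
      ext i j
      simp [V, Matrix.mul_apply, Matrix.one_apply]
    exact ⟨_, hS.1 _ _ _ hTZ _ (compression_mem hS hc hY hV), _,
      by rw [conjTuple_homog_directSum _ _ D 0, conjTuple_zero_left, add_zero]⟩

open scoped ComplexOrder in
-- The trace of R* R is the squared Hilbert–Schmidt norm of R, so the trace of the first entry is
-- strictly positive on the nonzero part of the cone.
theorem trace_of_mem_cone {A : Option (Fin d) → Matrix (Fin n) (Fin n) ℂ} (hA : A ∈ S.cone n) :
    ∃ t : ℝ, 0 ≤ t ∧ (A none).trace = t ∧ (t = 0 → A = 0) := by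
  obtain ⟨N, Z, R, hZ, rfl⟩ := hA
  have h : (conjTuple R Z.homog none).trace = (Rᴴ * R).trace := by simp [conjTuple_apply]
  have h0 := (Matrix.posSemidef_conjTranspose_mul_self R).trace_nonneg
  rw [Complex.nonneg_iff] at h0
  have h1 : (Rᴴ * R).trace = ((Rᴴ * R).trace.re : ℂ) := by
    apply Complex.ext <;> simp [← h0.2]
  refine ⟨(Rᴴ * R).trace.re, h0.1, h.trans h1, fun ht => ?_⟩
  rw [ht, Complex.ofReal_zero, Matrix.trace_conjTranspose_mul_self_eq_zero_iff] at h1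
  simp [h1]

/-- The base of the cone, cut out by the trace of the first entry. -/
def coneBase (S : FreeSet d) (n : ℕ) : Set (Option (Fin d) → Matrix (Fin n) (Fin n) ℂ) :=
  {A | A ∈ S.cone n ∧ (A none).trace = 1}

theorem convex_coneBase (hS : S.IsMatrixConvex) : Convex ℝ (S.coneBase n) := by
  rintro A ⟨hA, hA1⟩ B ⟨hB, hB1⟩ a b ha hb hab
  refine ⟨add_mem_cone hS (smul_mem_cone hA ha) (smul_mem_cone hB hb), ?_⟩
  simp only [Pi.add_apply, Pi.smul_apply, Matrix.trace_add, Matrix.trace_smul, hA1, hB1]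
  rw [← add_smul, hab, one_smul]

theorem isCompact_of_entries_bounded {ι : Type*} {s : Set (ι → Matrix (Fin m) (Fin n) ℂ)}
    (hs : IsClosed s) (C : ℝ) (hC : ∀ X ∈ s, ∀ j a b, ‖X j a b‖ ≤ C) : IsCompact s := by
  have hK : IsCompact (Set.univ.pi fun _ : ι => Set.univ.pi fun _ : Fin m => Set.univ.pi
      fun _ : Fin n => Metric.closedBall (0 : ℂ) C) :=
    isCompact_univ_pi fun _ => isCompact_univ_pi fun _ => isCompact_univ_pi fun _ =>
      isCompact_closedBall _ _
  exact IsCompact.of_isClosed_subset hK hs fun X hX j _ a _ b _ =>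
    mem_closedBall_zero_iff.2 (hC X hX j a b)

theorem isCompact_trace_conjTranspose_mul_self_eq_one :
    IsCompact {R : Matrix (Fin m) (Fin n) ℂ | (Rᴴ * R).trace = 1} := by
  have h : IsCompact {R : Unit → Matrix (Fin m) (Fin n) ℂ | ((R ())ᴴ * R ()).trace = 1} := by
    refine isCompact_of_entries_bounded ?_ 1 ?_
    · exact isClosed_eq (by fun_prop) continuous_const
    · intro R hR _ a b
      have h1 : ∑ j, ∑ i, ‖R () i j‖ ^ 2 = 1 := by
        have := congrArg Complex.re hR
        simpa [Matrix.trace, Matrix.mul_apply, ← Complex.normSq_eq_conj_mul_self,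
          Complex.normSq_eq_norm_sq, ← Complex.ofReal_pow] using this
      have h2 : ‖R () a b‖ ^ 2 ≤ 1 := by
        rw [← h1]
        refine le_trans ?_ (Finset.single_le_sum (f := fun j => ∑ i, ‖R () i j‖ ^ 2)
          (fun j _ => by positivity) (Finset.mem_univ b))
        exact Finset.single_le_sum (f := fun i => ‖R () i b‖ ^ 2)
          (fun j _ => by positivity) (Finset.mem_univ a)
      exact (sq_le_one_iff₀ (norm_nonneg _)).1 h2
  have := h.image (continuous_apply ())
  convert this using 1
  ext R
  exact ⟨fun h => ⟨fun _ => R, h, rfl⟩, fun ⟨Q, h, e⟩ => e ▸ h⟩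

/-- With points and coefficients both of size n, the base is a continuous image of a compact level
times a Hilbert–Schmidt sphere. -/
theorem isCompact_coneBase (hS : S.IsMatrixConvex) (hcl : S.IsLevelwiseClosed)
    (hb : S.IsLevelwiseBounded) {Y : MatTuple d n} (hY : Y ∈ S.level n) :
    IsCompact (S.coneBase n) := by
  obtain ⟨C, hC⟩ := hb n
  have h1 : IsCompact (S.level n) := isCompact_of_entries_bounded (hcl n) C hC
  have h2 := (h1.prod (isCompact_trace_conjTranspose_mul_self_eq_one (m := n) (n := n))).image
    (f := fun p => conjTuple p.2 p.1.homog) (by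
      refine continuous_pi fun o => ?_
      simp only [conjTuple_apply]
      cases o with
      | none => simp only [MatTuple.homog_none]; fun_prop
      | some j => simp only [MatTuple.homog_some]; fun_prop)
  convert h2 using 1
  ext A
  constructor
  · rintro ⟨hA, hA1⟩
    obtain ⟨Z, hZ, R, rfl⟩ := exists_square_of_mem_cone hS hY hA
    exact ⟨⟨Z, R⟩, ⟨hZ, by simpa [conjTuple_apply] using hA1⟩, rfl⟩
  · rintro ⟨⟨Z, R⟩, ⟨hZ, hR⟩, rfl⟩
    exact ⟨conjTuple_homog_mem_cone hZ R, by simpa [conjTuple_apply] using hR⟩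

theorem exists_eq_smul_of_mem_extremePoints {A P Q : Option (Fin d) → Matrix (Fin n) (Fin n) ℂ}
    (hA : A ∈ (S.coneBase n).extremePoints ℝ) (hP : P ∈ S.cone n) (hQ : Q ∈ S.cone n)
    (h : A = P + Q) : ∃ t : ℝ, 0 ≤ t ∧ P = t • A := by
  obtain ⟨t, ht, htP, ht0⟩ := trace_of_mem_cone hP
  obtain ⟨u, hu, huQ, hu0⟩ := trace_of_mem_cone hQ
  refine ⟨t, ht, ?_⟩
  have htu : t + u = 1 := by
    have := hA.1.2
    rw [h, Pi.add_apply, Matrix.trace_add, htP, huQ] at this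
    exact_mod_cast this
  rcases ht.eq_or_lt with rfl | ht'
  · rw [ht0 rfl, zero_smul]
  rcases hu.eq_or_lt with rfl | hu'
  · rw [hu0 rfl, add_zero] at h
    rw [add_zero] at htu
    rw [htu, one_smul, h]
  have hmem : ∀ {s : ℝ} {B : Option (Fin d) → Matrix (Fin n) (Fin n) ℂ}, 0 < s → B ∈ S.cone n →
      (B none).trace = s → s⁻¹ • B ∈ S.coneBase n := fun {s B} hs hB hBs =>
    ⟨smul_mem_cone hB (inv_nonneg.2 hs.le), by
      rw [Pi.smul_apply, Matrix.trace_smul, hBs, Complex.real_smul, ← Complex.ofReal_mul,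
        inv_mul_cancel₀ hs.ne', Complex.ofReal_one]⟩
  have hseg : A ∈ openSegment ℝ (t⁻¹ • P) (u⁻¹ • Q) :=
    ⟨t, u, ht', hu', htu, by
      rw [smul_smul, smul_smul, mul_inv_cancel₀ ht'.ne', mul_inv_cancel₀ hu'.ne', one_smul,
        one_smul, h]⟩
  rw [← hA.2 (hmem ht' hP htP) (hmem hu' hQ huQ) hseg, smul_smul, mul_inv_cancel₀ ht'.ne', one_smul]

open scoped ComplexOrder in
-- The first entry gives V* V = t, so V / √t is an isometry; full row rank makes it square, hence
-- unitary.
theorem unitarilyEquivalent_of_conjTuple_eq_smul {Y : MatTuple d m} {Z : MatTuple d n} (hn : 0 < n)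
    {V : Matrix (Fin m) (Fin n) ℂ} (hV : V.rank = m) (hV0 : V ≠ 0) {t : ℝ} (ht : 0 ≤ t)
    (h : conjTuple V Y.homog = t • Z.homog) : Y.UnitarilyEquivalent Z := by
  have h0 : Vᴴ * V = t • 1 := by simpa [conjTuple_apply] using congrFun h none
  have ht' : t ≠ 0 := by
    rintro rfl
    rw [zero_smul, Matrix.conjTranspose_mul_self_eq_zero] at h0
    exact hV0 h0
  have hU : conjTuple (Real.sqrt t⁻¹ • V) Y.homog = Z.homog := by
    rw [conjTuple_sqrt_smul _ (inv_nonneg.2 ht), h, smul_smul, inv_mul_cancel₀ ht', one_smul]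
  set U := Real.sqrt t⁻¹ • V with hUdef
  have hU1 : Uᴴ * U = 1 := by simpa [conjTuple_apply] using congrFun hU none
  have hmn : m = n := by
    refine le_antisymm (hV ▸ V.rank_le_width) ?_
    have : (1 : Matrix (Fin n) (Fin n) ℂ).rank ≤ U.rank := by
      rw [← hU1]
      exact Matrix.rank_mul_le_right _ _
    rw [Matrix.rank_one, Fintype.card_fin] at this
    exact this.trans U.rank_le_height
  subst hmn
  exact ⟨U, hU1, mul_eq_one_comm.1 hU1, fun j => (congrFun hU (some j)).symm⟩

/-- The tuples `R* (1, Z) R` with `Z` a matrix extreme point. -/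
def extremeCone (S : FreeSet d) (n : ℕ) : Set (Option (Fin d) → Matrix (Fin n) (Fin n) ℂ) :=
  {A | ∃ (N : ℕ) (Z : MatTuple d N) (R : Matrix (Fin N) (Fin n) ℂ),
    S.IsMatrixExtremePoint Z ∧ A = conjTuple R Z.homog}

/-- Write an extreme point of the base as D* (1, Y) D with D of full row rank. A proper combination
for Y, conjugated by D, splits the extreme point, so each summand is proportional to it. A right
inverse of D cancels D, and each point of the combination is then unitarily equivalent to Y. -/
theorem extremePoints_coneBase_subset (hS : S.IsMatrixConvex) :
    (S.coneBase n).extremePoints ℝ ⊆ S.extremeCone n := by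
  intro A hA
  obtain ⟨N, Z, R, hZ, rfl⟩ := hA.1.1
  have hR : R ≠ 0 := by
    rintro rfl
    simpa [conjTuple_apply] using hA.1.2
  obtain ⟨r, T, D, -, -, hD, -, hTZ, hDZ⟩ := exists_rank_eq_of_mem_cone hS R hR hZ
  obtain ⟨Y, hY⟩ : ∃ Y : MatTuple d r, Y = fun j => Tᴴ * Z j * T := ⟨_, rfl⟩
  rw [← hY] at hTZ hDZ
  rw [← hDZ] at hA ⊢
  refine ⟨r, Y, D, ⟨hTZ, fun k s W V hc hV i => ?_⟩, rfl⟩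
  rw [isMatrixConvexCombination_iff] at hc
  obtain ⟨E, hE⟩ := Matrix.exists_mul_eq_one_of_rank_eq hD
  have hVi : V i ≠ 0 := by
    intro h
    have h1 := hV i
    rw [h, Matrix.rank_zero] at h1
    exact (pos_of_mem_level (hc.1 i)).ne h1
  have hsum : conjTuple D Y.homog = conjTuple (V i * D) (W i).homog +
      ∑ j ∈ Finset.univ.erase i, conjTuple (V j * D) (W j).homog := by
    rw [Finset.add_sum_erase Finset.univ (fun j => conjTuple (V j * D) (W j).homog)
      (Finset.mem_univ i), hc.2, conjTuple_sum]
    simp only [conjTuple_conjTuple]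
  obtain ⟨t, ht, h⟩ := exists_eq_smul_of_mem_extremePoints hA
    (conjTuple_homog_mem_cone (hc.1 i) _)
    (sum_mem_cone hS (zero_mem_cone hTZ) _ fun j _ => conjTuple_homog_mem_cone (hc.1 j) _) hsum
  have h' := congrArg (conjTuple E) h
  rw [conjTuple_smul, conjTuple_conjTuple, conjTuple_conjTuple, Matrix.mul_assoc, hE,
    Matrix.mul_one, conjTuple_one] at h'
  exact unitarilyEquivalent_of_conjTuple_eq_smul (pos_of_mem_level hTZ) (hV i) hVi ht h'

theorem smul_mem_closure_extremeCone {A : Option (Fin d) → Matrix (Fin n) (Fin n) ℂ}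
    (hA : A ∈ AddSubmonoid.closure (S.extremeCone n)) {t : ℝ} (ht : 0 ≤ t) :
    t • A ∈ AddSubmonoid.closure (S.extremeCone n) := by
  induction hA using AddSubmonoid.closure_induction with
  | mem A hA =>
    obtain ⟨N, Z, R, hZ, rfl⟩ := hA
    exact AddSubmonoid.subset_closure ⟨N, Z, _, hZ, (conjTuple_sqrt_smul R ht _).symm⟩
  | zero => rw [smul_zero]; exact zero_mem _
  | add A B _ _ hA hB => rw [smul_add]; exact add_mem hA hB

open scoped Matrix.Norms.Elementwise in
/-- Every point of a closed and bounded matrix convex set is a matrix convex combination of matrix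
extreme points. -/
theorem homog_mem_closure_extremeCone (hS : S.IsMatrixConvex) (hcl : S.IsLevelwiseClosed)
    (hb : S.IsLevelwiseBounded) {Y : MatTuple d n} (hY : Y ∈ S.level n) :
    Y.homog ∈ AddSubmonoid.closure (S.extremeCone n) := by
  have hn : (0 : ℝ) < n := by exact_mod_cast pos_of_mem_level hY
  -- The identity has trace n, hence the normalisation.
  have h1 : (n : ℝ)⁻¹ • Y.homog ∈ S.coneBase n := by
    refine ⟨smul_mem_cone (homog_mem_cone_of_mem hY) (inv_nonneg.2 hn.le), ?_⟩
    have : (n : ℂ) ≠ 0 := by exact_mod_cast hn.ne'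
    simp [this]
  have h2 := subset_convexHull_extremePoints_of_isCompact (isCompact_coneBase hS hcl hb hY)
    (convex_coneBase hS) h1
  have h3 : (n : ℝ)⁻¹ • Y.homog ∈ AddSubmonoid.closure (S.extremeCone n) := by
    refine convexHull_min (t := (AddSubmonoid.closure (S.extremeCone n) : Set _))
      ((extremePoints_coneBase_subset hS).trans AddSubmonoid.subset_closure) ?_ h2
    intro A hA B hB a b ha hb _
    exact add_mem (smul_mem_closure_extremeCone hA ha) (smul_mem_closure_extremeCone hB hb)
  have h4 := smul_mem_closure_extremeCone h3 hn.le
  rwa [smul_smul, mul_inv_cancel₀ hn.ne', one_smul] at h4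

end FreeSet

/-! ### Crucial points and splitting off a direct summand -/

/-- An isometry admits a complementary isometry. -/
theorem Matrix.exists_isometry_complement {m n : ℕ} {T : Matrix (Fin m) (Fin n) ℂ}
    (hT : Tᴴ * T = 1) : ∃ (p : ℕ) (Q : Matrix (Fin m) (Fin p) ℂ),
      Qᴴ * Q = 1 ∧ Tᴴ * Q = 0 ∧ T * Tᴴ + Q * Qᴴ = 1 := by
  -- The columns of Q form an orthonormal basis of the range of the projection 1 - T T*.
  obtain ⟨p, Q, D, hQ, hP, hD, -⟩ := Matrix.exists_isometry_mul (1 - T * Tᴴ)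
  obtain ⟨E, hE⟩ := Matrix.exists_mul_eq_one_of_rank_eq hD
  have hQE : Q = (1 - T * Tᴴ) * E := by rw [hP, Matrix.mul_assoc, hE, Matrix.mul_one]
  have hTQ : Tᴴ * Q = 0 := by
    rw [hQE, ← Matrix.mul_assoc, Matrix.mul_sub, ← Matrix.mul_assoc, hT]
    simp
  have hQT : Qᴴ * T = 0 := by
    rw [← Matrix.conjTranspose_conjTranspose T, ← Matrix.conjTranspose_mul, hTQ,
      Matrix.conjTranspose_zero]
  refine ⟨p, Q, hQ, hTQ, ?_⟩
  have h : Q * Qᴴ = Q * Qᴴ * (1 - T * Tᴴ) := by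
    rw [Matrix.mul_sub, Matrix.mul_assoc Q Qᴴ (T * Tᴴ), ← Matrix.mul_assoc Qᴴ T, hQT]
    simp
  rw [h, hP, Matrix.mul_assoc, ← Matrix.mul_assoc Qᴴ, hQ, Matrix.one_mul, ← hP]
  abel

namespace FreeSet

variable {d : ℕ} {S : FreeSet d} {m n : ℕ}

/-- Matrix extremality is invariant under unitary equivalence. If X lacked it, no matrix extreme
point would be equivalent to X, and the hull of the remaining ones would contain X. -/
theorem IsCrucialMatrixExtremePoint.isMatrixExtremePoint (hS : S.IsMatrixConvex)
    (hcl : S.IsLevelwiseClosed) (hb : S.IsLevelwiseBounded) {X : MatTuple d n}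
    (hX : S.IsCrucialMatrixExtremePoint X) : S.IsMatrixExtremePoint X := by
  have hn := pos_of_mem_level hX.1
  by_contra hne
  refine hX.2 ⟨hn, fun T hT _ hC => mem_of_homog_mem_cone hT hn ?_⟩
  -- Zero is kept apart because the cone of T is empty if T has no points.
  have key : ∀ A ∈ AddSubmonoid.closure (S.extremeCone n), A = 0 ∨ A ∈ T.cone n := by
    intro A hA
    induction hA using AddSubmonoid.closure_induction with
    | mem A hA =>
      obtain ⟨N, Z, R, hZ, rfl⟩ := hA
      exact Or.inr (conjTuple_homog_mem_cone
        (hC N ⟨hZ, fun h => hne (hZ.of_unitarilyEquivalent hS h)⟩) R)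
    | zero => exact Or.inl rfl
    | add A B _ _ hA hB =>
      rcases hA with rfl | hA
      · rwa [zero_add]
      rcases hB with rfl | hB
      · rw [add_zero]
        exact Or.inr hA
      · exact Or.inr (add_mem_cone hT hA hB)
  refine (key _ (homog_mem_closure_extremeCone hS hcl hb hX.1)).resolve_left fun h => ?_
  have h1 := congrFun (congrFun (congrFun h none) ⟨0, hn⟩) ⟨0, hn⟩
  simp at h1

/-- If `V* A V` is a summand of a crucial matrix extreme point `X`, where `A` is a sum of multiples
of matrix extreme points, then `V` intertwines `A` and `X`. -/
theorem IsCrucialMatrixExtremePoint.exists_intertwining (hS : S.IsMatrixConvex)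
    (hcl : S.IsLevelwiseClosed) (hb : S.IsLevelwiseBounded) {X : MatTuple d n}
    (hX : S.IsCrucialMatrixExtremePoint X) (V : Matrix (Fin m) (Fin n) ℂ)
    {A : Option (Fin d) → Matrix (Fin m) (Fin m) ℂ}
    (hA : A ∈ AddSubmonoid.closure (S.extremeCone m))
    (h : ∃ B ∈ S.cone n, X.homog = conjTuple V A + B) :
    ∃ (C : Matrix (Fin m) (Fin n) ℂ) (t : ℂ), (∀ o, A o * V = C * X.homog o) ∧
      (∀ o, (A o)ᴴ * V = C * (X.homog o)ᴴ) ∧ Vᴴ * C = t • (1 : Matrix (Fin n) (Fin n) ℂ) := by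
  have hn := pos_of_mem_level hX.1
  have hXm := hX.isMatrixExtremePoint hS hcl hb
  have hcone : ∀ A ∈ AddSubmonoid.closure (S.extremeCone m), A ∈ S.cone m := by
    intro A hA
    induction hA using AddSubmonoid.closure_induction with
    | mem A hA =>
      obtain ⟨N, Z, R, hZ, rfl⟩ := hA
      exact conjTuple_homog_mem_cone hZ.1 R
    | zero => exact zero_mem_cone hX.1
    | add A B _ _ hA hB => exact add_mem_cone hS hA hB
  induction hA using AddSubmonoid.closure_induction with
  | mem A hA =>
    obtain ⟨N, Z, W, hZ, rfl⟩ := hA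
    obtain ⟨B, hB, h⟩ := h
    rw [conjTuple_conjTuple] at h
    by_cases hWV : W * V = 0
    · refine ⟨0, 0, fun o => ?_, fun o => ?_, by simp⟩
      · rw [conjTuple_apply, Matrix.mul_assoc, hWV]
        simp
      · rw [conjTranspose_conjTuple_apply, Matrix.mul_assoc, hWV]
        simp
    obtain ⟨-, T, hT, hTX⟩ := hXm.exists_isometry hS hZ.1 hWV hB h
    -- Otherwise Z belongs to C, and X, a compression of Z, lies in its hull.
    have hZX : Z.UnitarilyEquivalent X := by
      by_contra hne
      refine hX.2 ⟨hn, fun K hK _ hC => mem_of_homog_mem_cone hK hn ?_⟩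
      rw [hTX]
      exact conjTuple_homog_mem_cone (hC N ⟨hZ, hne⟩) T
    obtain ⟨U, hU1, hU2, hU⟩ := hZX.symm
    have hZ' : Z.homog = conjTuple U X.homog := by
      rw [← X.homog_compression hU1]
      exact congrArg MatTuple.homog (funext hU)
    rw [hZ', conjTuple_conjTuple] at h ⊢
    rw [← Matrix.mul_assoc] at h
    obtain ⟨c, hc⟩ := hXm.exists_eq_smul_one hS hB h
    -- With U W V = c, the product A V = (U W)* (1, X) U W V becomes c (U W)* (1, X).
    refine ⟨c • (U * W)ᴴ, star c * c, fun o => ?_, fun o => ?_, ?_⟩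
    · rw [conjTuple_apply, Matrix.mul_assoc, hc]
      simp
    · rw [conjTranspose_conjTuple_apply, Matrix.mul_assoc, hc]
      simp
    · rw [Matrix.mul_smul, ← Matrix.conjTranspose_mul, hc, Matrix.conjTranspose_smul,
        Matrix.conjTranspose_one, smul_smul, mul_comm]
  | zero => exact ⟨0, 0, by simp, by simp, by simp⟩
  | add A A' hA hA' ih ih' =>
    obtain ⟨B, hB, h⟩ := h
    rw [conjTuple_add] at h
    -- For each summand, the other one is absorbed into the remainder.
    obtain ⟨C, t, h1, h2, h3⟩ := ih ⟨conjTuple V A' + B,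
      add_mem_cone hS (conjTuple_mem_cone (hcone _ hA') V) hB, by rw [h, add_assoc]⟩
    obtain ⟨C', t', h1', h2', h3'⟩ := ih' ⟨conjTuple V A + B,
      add_mem_cone hS (conjTuple_mem_cone (hcone _ hA) V) hB, by rw [h, add_left_comm, add_assoc]⟩
    refine ⟨C + C', t + t', fun o => ?_, fun o => ?_, ?_⟩
    · rw [Pi.add_apply, Matrix.add_mul, Matrix.add_mul, h1, h1']
    · rw [Pi.add_apply, Matrix.conjTranspose_add, Matrix.add_mul, Matrix.add_mul, h2, h2']
    · rw [Matrix.mul_add, h3, h3', add_smul]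

/-- The two relations say that the range of T reduces Y. The compression of Y to the orthogonal
complement is Z; it is absent when T is already unitary, as there is no level of size 0. -/
theorem unitarilyEquivalent_or_directSum_of_isometry (hS : S.IsMatrixConvex) {Y : MatTuple d m}
    (hY : Y ∈ S.level m) {X : MatTuple d n} {T : Matrix (Fin m) (Fin n) ℂ} (hT : Tᴴ * T = 1)
    (h1 : ∀ j, Y j * T = T * X j) (h2 : ∀ j, (Y j)ᴴ * T = T * (X j)ᴴ) :
    Y.UnitarilyEquivalent X ∨ ∃ (p : ℕ) (Z : MatTuple d p), Z ∈ S.level p ∧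
      Y.UnitarilyEquivalent (X.directSum Z) := by
  obtain ⟨p, Q, hQ, hTQ, hTT⟩ := Matrix.exists_isometry_complement hT
  have hQT : Qᴴ * T = 0 := by
    rw [← Matrix.conjTranspose_conjTranspose T, ← Matrix.conjTranspose_mul, hTQ,
      Matrix.conjTranspose_zero]
  have h2' : ∀ j, Tᴴ * Y j = X j * Tᴴ := fun j => by
    simpa using congrArg Matrix.conjTranspose (h2 j)
  have hTYT : ∀ j, Tᴴ * Y j * T = X j := fun j => by
    rw [h2', Matrix.mul_assoc, hT, Matrix.mul_one]
  rcases Nat.eq_zero_or_pos p with rfl | hp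
  · left
    have : Q * Qᴴ = 0 := by ext; simp [Matrix.mul_apply]
    rw [this, add_zero] at hTT
    exact ⟨T, hT, hTT, fun j => (hTYT j).symm⟩
  · right
    refine ⟨p, _, compression_mem hS hp hY hQ,
      Matrix.reindex (Equiv.refl _) finSumFinEquiv (Matrix.fromCols T Q), ?_, ?_, fun j => ?_⟩
    · simp only [Matrix.reindex_apply, Matrix.conjTranspose_submatrix, Matrix.submatrix_mul_equiv,
        Matrix.conjTranspose_fromCols_eq_fromRows_conjTranspose, Matrix.fromRows_mul_fromCols,
        hT, hQ, hTQ, hQT, Matrix.fromBlocks_one]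
      simp
    · simp only [Matrix.reindex_apply, Matrix.conjTranspose_submatrix, Matrix.submatrix_mul_equiv,
        Matrix.conjTranspose_fromCols_eq_fromRows_conjTranspose, Matrix.fromCols_mul_fromRows, hTT]
      simp
    · have hb : (Matrix.fromCols T Q)ᴴ * Y j * Matrix.fromCols T Q =
          Matrix.fromBlocks (X j) 0 0 (Qᴴ * Y j * Q) := by
        rw [Matrix.conjTranspose_fromCols_eq_fromRows_conjTranspose, Matrix.fromRows_mul,
          Matrix.fromRows_mul_fromCols, hTYT, h2', Matrix.mul_assoc, hTQ, Matrix.mul_zero,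
          Matrix.mul_assoc Qᴴ (Y j) T, h1, ← Matrix.mul_assoc, hQT, Matrix.zero_mul]
      rw [MatTuple.directSum, ← hb]
      rfl

end FreeSet

theorem proposition2p4 (d : ℕ) (hd : 0 < d) (S : FreeSet d) (hconv : S.IsMatrixConvex)
    (hclosed : S.IsLevelwiseClosed) (hbdd : S.IsLevelwiseBounded) (n : ℕ) (X : MatTuple d n)
    (hX : S.IsCrucialMatrixExtremePoint X) :
    S.IsAbsoluteExtremePoint X := by
  refine ⟨hX.1, fun k s Y V hc hV i => ?_⟩
  rw [FreeSet.isMatrixConvexCombination_iff] at hc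
  have hsum : X.homog = conjTuple (V i) (Y i).homog +
      ∑ j ∈ Finset.univ.erase i, conjTuple (V j) (Y j).homog := by
    rw [Finset.add_sum_erase Finset.univ (fun j => conjTuple (V j) (Y j).homog)
      (Finset.mem_univ i), hc.2]
  obtain ⟨C, t, h1, h2, h3⟩ := hX.exists_intertwining hconv hclosed hbdd (V i)
    (FreeSet.homog_mem_closure_extremeCone hconv hclosed hbdd (hc.1 i))
    ⟨_, FreeSet.sum_mem_cone hconv (FreeSet.zero_mem_cone hX.1) _
      fun j _ => FreeSet.conjTuple_homog_mem_cone (hc.1 j) _, hsum⟩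
  -- The homogenising entry of the intertwining relation reads 1 · V = C · 1.
  obtain rfl : V i = C := by simpa using h1 none
  have hn := FreeSet.pos_of_mem_level hX.1
  -- The scalar V* V is the squared norm of the first column of V, hence real and nonnegative.
  have ht : t = ((∑ a, Complex.normSq (V i a ⟨0, hn⟩) : ℝ) : ℂ) := by
    have := congrFun (congrFun h3 ⟨0, hn⟩) ⟨0, hn⟩
    simpa [Matrix.mul_apply, ← Complex.normSq_eq_conj_mul_self] using this.symm
  set u : ℝ := ∑ a, Complex.normSq (V i a ⟨0, hn⟩) with hu
  have hu0 : 0 ≤ u := Finset.sum_nonneg fun _ _ => Complex.normSq_nonneg _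
  have hune : u ≠ 0 := by
    intro h
    open scoped ComplexOrder in
    rw [ht, h, Complex.ofReal_zero, zero_smul, Matrix.conjTranspose_mul_self_eq_zero] at h3
    exact hV i h3
  refine FreeSet.unitarilyEquivalent_or_directSum_of_isometry hconv (hc.1 i)
    (T := Real.sqrt u⁻¹ • V i) ?_ (fun j => ?_) (fun j => ?_)
  · rw [Matrix.conjTranspose_smul, Matrix.smul_mul, Matrix.mul_smul, smul_smul, star_trivial,
      Real.mul_self_sqrt (inv_nonneg.2 hu0), h3, ht, Complex.coe_smul, smul_smul,
      inv_mul_cancel₀ hune, one_smul]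
  · rw [Matrix.mul_smul, Matrix.smul_mul]
    exact congrArg _ (h1 (some j))
  · rw [Matrix.mul_smul, Matrix.smul_mul]
    exact congrArg _ (h2 (some j))
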